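/- **Theorem.** Let $\mathbb K\in\{\mathbb R,\mathbb C\}$, let $X$ be a locally compact Hausdorff space, and let $V\neq\{0\}$ be a metrizable topological vector space over $\mathbb K$. Let $C_{cpt}(X,V)$ be the additive group of continuous functions $f\colon X\to V$ whose support $\operatorname{cl}_X\{x\in X\mid f(x)\neq 0\}$ is compact, with the topology of uniform convergence on $X$ (with respect to the uniformity of the additive group $V$). For each compact $K\subseteq X$, let $C_K(X,V)$ be the subgroup of those $f\in C_{cpt}(X,V)$ whose support is contained in $K$, with the subspace topology; these subgroups form a directed family with union $C_{cpt}(X,V)$. Say that the family $\{C_K(X,V)\}_K$, indexed by all compact subsets $K$ of $X$, satisfies ACP (the algebraic colimit property) if on the group $C_{cpt}(X,V)$ the finest topology making all inclusions $C_K(X,V)\to C_{cpt}(X,V)$ continuous coincides with the finest group topology making all these inclusions continuous. Consider the following statements: 1. the family $\{C_K(X,V)\}_K$ satisfies ACP; 2. $X$ is homeomorphic to the discrete space $\mathbb N$, and $V$ is finite-dimensional. (B) If $X$ is not pseudocompact, that is, if there is an unbounded continuous function $X\to\mathbb R$, then (1) and (2) are equivalent. (B′) If $X$ contains a $\sigma$-compact,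 non-compact subset $A$ that is regular closed (that is, $A=\operatorname{cl}_X(\operatorname{int}_X A)$), then (1) and (2) are equivalent. -/

import Mathlib

open scoped CompactlySupported

noncomputable section

/-! ### Colimit topologies of a family of topological groups, and the property ACP

A directed family of topological groups is given internally: the groups `H i` are subgroups of
their union `G`, the inclusions are the structure maps, and each `H i` carries a topology `t i`
of its own. -/

/-- The colimit space topology: the finest topology on `G` that makes every inclusion
`H i → G` continuous (in Mathlib's order on topologies, finer means smaller). -/
@[reducible] def colimitSpaceTopology {G : Type*} [AddGroup G] {I : Type*} (H : I → AddSubgroup G)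
    (t : ∀ i, TopologicalSpace (H i)) : TopologicalSpace G :=
  ⨆ i, TopologicalSpace.coinduced (Subtype.val : H i → G) (t i)

/-- The colimit group topology: the finest group topology on `G` that makes every inclusion
`H i → G` continuous. -/
def colimitGroupTopology {G : Type*} [AddGroup G] {I : Type*} (H : I → AddSubgroup G)
    (t : ∀ i, TopologicalSpace (H i)) : AddGroupTopology G :=
  sInf {τ : AddGroupTopology G |
    ∀ i, @Continuous (H i) G (t i) τ.toTopologicalSpace Subtype.val}

/-- The algebraic colimit property of a directed family of topological groups with union `G`: the
colimit space topology and the colimit group topology on `G` coincide. -/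
def SatisfiesACP {G : Type*} [AddGroup G] {I : Type*} (H : I → AddSubgroup G)
    (t : ∀ i, TopologicalSpace (H i)) : Prop :=
  colimitSpaceTopology H t = (colimitGroupTopology H t).toTopologicalSpace

/-! ### Continuous functions with compact support -/

section CompactSupport

variable (X V : Type*) [TopologicalSpace X] [AddCommGroup V] [TopologicalSpace V]
  [IsTopologicalAddGroup V]

/-- The uniform topology on the group `C_c(X, V)` of compactly supported continuous functions:
the topology of uniform convergence on `X`, for the group uniformity of `V`. -/
@[reducible] def uniformTopology : TopologicalSpace C_c(X, V) :=
  TopologicalSpace.induced (fun f : C_c(X, V) => UniformFun.ofFun (f : X → V))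
    (@UniformFun.topologicalSpace X V (IsTopologicalAddGroup.rightUniformSpace V))

/-- `C_K(X, V)`: the subgroup of those `f : C_c(X, V)` whose support
`closure {x | f x ≠ 0}` is contained in the compact set `K`. -/
def supportedIn (K : TopologicalSpace.Compacts X) : AddSubgroup C_c(X, V) where
  carrier := {f | tsupport f ⊆ (K : Set X)}
  zero_mem' := by simp [tsupport]
  add_mem' {f g} hf hg := (tsupport_add (f : X → V) g).trans (Set.union_subset hf hg)
  neg_mem' {f} hf := by
    have h : tsupport (-f : C_c(X, V)) = tsupport f := by
      simp [tsupport, Function.support_neg]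
    exact (h.subset).trans hf

/-- `C_K(X, V)` carries the subspace topology of the uniform topology. -/
@[reducible] def supportedInTopology (K : TopologicalSpace.Compacts X) :
    TopologicalSpace (supportedIn X V K) :=
  TopologicalSpace.induced Subtype.val (uniformTopology X V)

end CompactSupport

/-! ### Topological notions -/

/-- A space is pseudocompact if every continuous real-valued function on it is bounded. -/
def IsPseudocompact (X : Type*) [TopologicalSpace X] : Prop :=
  ∀ f : X → ℝ, Continuous f → ∃ M : ℝ, ∀ x, |f x| ≤ M

/-- A set is regular closed if it is the closure of its interior. -/
def IsRegularClosed {X : Type*} [TopologicalSpace X] (A : Set X) : Prop :=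
  closure (interior A) = A

end

/-!
Both hypotheses on `X` give a sequence `y` in `X` that leaves every compact set, and the equivalence
holds for every `X` that has such a sequence (`satisfiesACP_iff_of_tendsto_cocompact`).

ACP means that the colimit space topology on `C_c(X, V)`, in which a set is closed if and only if
its trace on each `C_K(X, V)` is, is a group topology. It is refuted by exhibiting a closed set `S`
with `0 ∉ S` that meets `W + W` for every neighbourhood `W` of `0`. There are two such
constructions.

* If some `C_K(X, V)` is not locally compact, every neighbourhood of `0` in it contains a sequence
  without cluster points. Let `a n` be such sequences in smaller and smaller neighbourhoods, and let
  `b n k` be functions that tend to `0` as `k → ∞` and do not vanish at `y n`. Then `S` consists of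
  the sums `a n k + b n k` with `y n ∉ K`. A set `C_L(X, V)` contains such a sum only if `y n ∈ L`,
  hence only for finitely many `n`, and so `S` is closed. Under ACP, therefore, every `C_K(X, V)`
  has a neighbourhood of `0` all of whose sequences have cluster points
  (`SatisfiesACP.exists_nhds_forall_mapClusterPt`). Applied to multiples of one bump function, this
  makes a neighbourhood of `0` in `V` totally bounded, so that `V` is finite-dimensional by Riesz's
  theorem; applied to bump functions with disjoint supports near a non-isolated point, it shows that
  `X` is discrete.
* If `X` is discrete and uncountable, `S` consists of functions with two-point supports, whose sizes
  are governed by a function on pairs in `ω₁` that no function on `ω₁` dominates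
  (`exists_nat_undominated_of_uncountable`, `SatisfiesACP.countable`).

Conversely, if `X` is `ℕ` and `V` is finite-dimensional, then `C_c(X, V)` is the union of an
increasing sequence of locally compact groups, the finite powers of `V`. For such a union the colimit
space topology is a group topology (`satisfiesACP_of_locallyCompact`): if `f + g` lies in an open set
`U`, compact neighbourhoods of `f` and `g` whose sum stays in `U` are enlarged from each group of the
sequence to the next by the tube lemma.
-/

open Filter Set Topology TopologicalSpace

/-! ### Colimit topologies -/

theorem isOpen_colimitSpaceTopology_iff {G : Type*} [AddGroup G] {I : Type*}
    {H : I → AddSubgroup G} {t : ∀ i, TopologicalSpace (H i)} {U : Set G} :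
    IsOpen[colimitSpaceTopology H t] U ↔
      ∀ i, IsOpen[t i] ((Subtype.val : H i → G) ⁻¹' U) := by
  simp only [isOpen_iSup_iff, isOpen_coinduced]

/-- Under ACP the colimit space topology has a continuous addition; at `0 + 0` this gives, for a
closed set `S` not containing `0`, an open neighbourhood `W` of `0` with `W + W` disjoint from
`S`. -/
theorem SatisfiesACP.exists_add_notMem {G : Type*} [AddGroup G] {I : Type*}
    {H : I → AddSubgroup G} {t : ∀ i, TopologicalSpace (H i)} (h : SatisfiesACP H t)
    {S : Set G} (hS : ∀ i, IsClosed[t i] ((Subtype.val : H i → G) ⁻¹' S)) (h0 : (0 : G) ∉ S) :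
    ∃ W : Set G, 0 ∈ W ∧ (∀ i, IsOpen[t i] ((Subtype.val : H i → G) ⁻¹' W)) ∧
      ∀ f ∈ W, ∀ g ∈ W, f + g ∉ S := by
  let T : TopologicalSpace G := colimitSpaceTopology H t
  have hT : T = (colimitGroupTopology H t).toTopologicalSpace := h
  have : IsTopologicalAddGroup G := by
    rw [hT]; exact (colimitGroupTopology H t).toIsTopologicalAddGroup
  have hSo : IsOpen Sᶜ := by
    refine isOpen_colimitSpaceTopology_iff.2 fun i => ?_
    let := t i
    exact (hS i).isOpen_compl
  have hmem : (fun p : G × G => p.1 + p.2) ⁻¹' Sᶜ ∈ 𝓝 ((0 : G), (0 : G)) :=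
    (hSo.preimage continuous_add).mem_nhds (by simpa using h0)
  rw [nhds_prod_eq, mem_prod_self_iff] at hmem
  obtain ⟨W', hW', hsub⟩ := hmem
  obtain ⟨W, hWW', hWo, h0W⟩ := mem_nhds_iff.1 hW'
  exact ⟨W, h0W, isOpen_colimitSpaceTopology_iff.1 hWo,
    fun f hf g hg => hsub (mk_mem_prod (hWW' hf) (hWW' hg))⟩

/-- If the colimit space topology is a group topology, then ACP holds. -/
theorem satisfiesACP_of_isTopologicalAddGroup {G : Type*} [AddGroup G] {I : Type*}
    {H : I → AddSubgroup G} {t : ∀ i, TopologicalSpace (H i)}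
    (h : @IsTopologicalAddGroup G (colimitSpaceTopology H t) _) : SatisfiesACP H t := by
  refine le_antisymm ?_ ?_
  · have : (colimitGroupTopology H t).toTopologicalSpace =
        sInf (AddGroupTopology.toTopologicalSpace '' {τ : AddGroupTopology G |
          ∀ i, @Continuous (H i) G (t i) τ.toTopologicalSpace Subtype.val}) :=
      AddGroupTopology.toTopologicalSpace_sInf _
    rw [this]
    refine le_sInf ?_
    rintro _ ⟨τ, hτ, rfl⟩
    exact iSup_le fun i => continuous_iff_coinduced_le.1 (hτ i)
  · let τ : AddGroupTopology G := ⟨colimitSpaceTopology H t, h⟩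
    have hle : colimitGroupTopology H t ≤ τ :=
      sInf_le fun i => continuous_iff_coinduced_le.2
        (le_iSup (fun i => TopologicalSpace.coinduced (Subtype.val : H i → G) (t i)) i)
    exact hle

/-- In a locally compact group, a pair of compact sets whose sum lies in an open set can be
enlarged to compact neighbourhoods with the same property. -/
theorem exists_compact_nhds_add_subset {L : Type*} [AddGroup L] [TopologicalSpace L]
    [IsTopologicalAddGroup L] [LocallyCompactSpace L] {A B U : Set L} (hA : IsCompact A)
    (hB : IsCompact B) (hU : IsOpen U) (hAB : ∀ a ∈ A, ∀ b ∈ B, a + b ∈ U) :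
    ∃ A' B' : Set L, IsCompact A' ∧ IsCompact B' ∧ A ⊆ interior A' ∧ B ⊆ interior B' ∧
      ∀ a ∈ A', ∀ b ∈ B', a + b ∈ U := by
  obtain ⟨P, Q, hP, hQ, hAP, hBQ, hPQ⟩ := generalized_tube_lemma hA hB
    (hU.preimage (continuous_add (M := L))) (fun p hp => hAB p.1 hp.1 p.2 hp.2)
  obtain ⟨A', hA', hAA', hA'P⟩ := exists_compact_between hA hP hAP
  obtain ⟨B', hB', hBB', hB'Q⟩ := exists_compact_between hB hQ hBQ
  exact ⟨A', B', hA', hB', hAA', hBB', fun a ha b hb => hPQ (mk_mem_prod (hA'P ha) (hB'Q hb))⟩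

section SequentialColimit

variable {G : Type*} [AddGroup G] [TopologicalSpace G]

theorem mem_of_image_inclusion_subset_interior {H : ℕ → AddSubgroup G} (hH : Monotone H)
    (A : ∀ n, Set (H n))
    (hA : ∀ n, AddSubgroup.inclusion (hH n.le_succ) '' A n ⊆ interior (A (n + 1)))
    {n : ℕ} (k : ℕ) {x : G} (h : x ∈ H n) (hx : (⟨x, h⟩ : H n) ∈ A n) :
    (⟨x, hH (Nat.le_add_right n k) h⟩ : H (n + k)) ∈ A (n + k) := by
  induction k with
  | zero => exact hx
  | succ k ih => exact interior_subset (hA (n + k) ⟨_, ih, rfl⟩)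

/-- If each `A n ⊆ H n` lies in the interior of `A (n + 1)` in `H (n + 1)`, then the union of these
interiors meets every `H m` in an open set. -/
theorem isOpen_iUnion_interior {H : ℕ → AddSubgroup G} (hH : Monotone H)
    (A : ∀ n, Set (H n))
    (hA : ∀ n, AddSubgroup.inclusion (hH n.le_succ) '' A n ⊆ interior (A (n + 1))) (m : ℕ) :
    IsOpen ((Subtype.val : H m → G) ⁻¹'
      {x | ∃ n, ∃ h : x ∈ H n, (⟨x, h⟩ : H n) ∈ interior (A n)}) := by
  rw [isOpen_iff_mem_nhds]
  rintro ⟨x, hxm⟩ ⟨n, h, hx⟩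
  have hx' := hA (n + m)
    ⟨_, mem_of_image_inclusion_subset_interior hH A hA m h (interior_subset hx), rfl⟩
  have hm : H m ≤ H (n + m + 1) := hH (by lia)
  have hc : Continuous (AddSubgroup.inclusion hm) := continuous_inclusion hm
  refine mem_of_superset ((isOpen_interior.preimage hc).mem_nhds hx') ?_
  intro y hy
  exact ⟨n + m + 1, hm y.2, hy⟩

/-- Addition is jointly continuous for the colimit space topology of an increasing sequence of
locally compact groups: compact neighbourhoods are enlarged step by step along the sequence. -/
theorem exists_open_add_subset_of_locallyCompact [IsTopologicalAddGroup G]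
    {H : ℕ → AddSubgroup G} (hH : Monotone H) (hlc : ∀ n, LocallyCompactSpace (H n))
    {U : Set G} (hU : ∀ n, IsOpen ((Subtype.val : H n → G) ⁻¹' U))
    {f g : G} (hf : f ∈ H 0) (hg : g ∈ H 0) (hfg : f + g ∈ U) :
    ∃ A B : Set G, f ∈ A ∧ g ∈ B ∧ (∀ n, IsOpen ((Subtype.val : H n → G) ⁻¹' A)) ∧
      (∀ n, IsOpen ((Subtype.val : H n → G) ⁻¹' B)) ∧ ∀ a ∈ A, ∀ b ∈ B, a + b ∈ U := by
  let P : ℕ → Type _ := fun n => {p : Set (H n) × Set (H n) // IsCompact p.1 ∧ IsCompact p.2 ∧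
    ∀ a ∈ p.1, ∀ b ∈ p.2, (a + b : G) ∈ U}
  have step : ∀ n (p : P n), ∃ q : P (n + 1),
      AddSubgroup.inclusion (hH n.le_succ) '' p.1.1 ⊆ interior q.1.1 ∧
      AddSubgroup.inclusion (hH n.le_succ) '' p.1.2 ⊆ interior q.1.2 := by
    rintro n ⟨⟨A, B⟩, hA, hB, hAB⟩
    have hc : Continuous (AddSubgroup.inclusion (hH n.le_succ)) :=
      continuous_inclusion (hH n.le_succ)
    have := hlc (n + 1)
    obtain ⟨A', B', hA', hB', hAA', hBB', h⟩ := exists_compact_nhds_add_subset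
      (hA.image hc) (hB.image hc) (hU (n + 1)) (by
        rintro _ ⟨a, ha, rfl⟩ _ ⟨b, hb, rfl⟩
        exact hAB a ha b hb)
    exact ⟨⟨(A', B'), hA', hB', fun a ha b hb => h a ha b hb⟩, hAA', hBB'⟩
  choose next hnextA hnextB using step
  let p0 : P 0 := ⟨({⟨f, hf⟩}, {⟨g, hg⟩}), isCompact_singleton, isCompact_singleton, by
    rintro _ rfl _ rfl
    exact hfg⟩
  let s : ∀ n, P n := fun n => Nat.rec p0 next n
  have hsA : ∀ n, AddSubgroup.inclusion (hH n.le_succ) '' (s n).1.1 ⊆ interior (s (n + 1)).1.1 :=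
    fun n => hnextA n (s n)
  have hsB : ∀ n, AddSubgroup.inclusion (hH n.le_succ) '' (s n).1.2 ⊆ interior (s (n + 1)).1.2 :=
    fun n => hnextB n (s n)
  refine ⟨{x | ∃ n, ∃ h : x ∈ H n, (⟨x, h⟩ : H n) ∈ interior (s n).1.1},
    {x | ∃ n, ∃ h : x ∈ H n, (⟨x, h⟩ : H n) ∈ interior (s n).1.2},
    ⟨1, hH zero_le_one hf, hsA 0 ⟨_, rfl, rfl⟩⟩, ⟨1, hH zero_le_one hg, hsB 0 ⟨_, rfl, rfl⟩⟩,
    isOpen_iUnion_interior hH (fun n => (s n).1.1) hsA,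
    isOpen_iUnion_interior hH (fun n => (s n).1.2) hsB, ?_⟩
  rintro a ⟨n, ha, han⟩ b ⟨m, hb, hbm⟩
  have h1 := mem_of_image_inclusion_subset_interior hH (fun n => (s n).1.1) hsA m ha
     (interior_subset han)
  have h2 := mem_of_image_inclusion_subset_interior hH (fun n => (s n).1.2) hsB n hb
     (interior_subset hbm)
  have key : ∀ N M (e : N = M) (hN : a ∈ H N) (hM : b ∈ H M), (⟨a, hN⟩ : H N) ∈ (s N).1.1 →
      (⟨b, hM⟩ : H M) ∈ (s M).1.2 → a + b ∈ U := by
    rintro N _ rfl hN hM h1 h2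
    exact (s N).2.2.2 _ h1 _ h2
  exact key _ _ (Nat.add_comm n m) _ _ h1 h2

/-- A directed family of subgroups that has a cofinal increasing sequence of locally compact
members, with union the whole group, satisfies ACP. -/
theorem satisfiesACP_of_locallyCompact [IsTopologicalAddGroup G] {I : Type*}
    (H : I → AddSubgroup G) (i : ℕ → I) (hmono : Monotone (H ∘ i))
    (hcof : ∀ j, ∃ n, H j ≤ H (i n)) (hunion : ∀ f, ∃ n, f ∈ H (i n))
    (hlc : ∀ n, LocallyCompactSpace (H (i n))) :
    SatisfiesACP H (fun _ => instTopologicalSpaceSubtype) := by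
  have hopen : ∀ (U : Set G) (k : ℕ), (∀ n, IsOpen ((Subtype.val : H (i (k + n)) → G) ⁻¹' U)) →
      ∀ j, IsOpen ((Subtype.val : H j → G) ⁻¹' U) := by
    intro U k hU j
    obtain ⟨n, hn⟩ := hcof j
    have hn' : H j ≤ H (i (k + n)) := hn.trans (hmono (Nat.le_add_left n k))
    exact (hU n).preimage (continuous_inclusion hn')
  refine satisfiesACP_of_isTopologicalAddGroup ?_
  refine @IsTopologicalAddGroup.mk G (colimitSpaceTopology H _) _ ?_ ?_
  · refine @ContinuousAdd.mk G (colimitSpaceTopology H _) _ ?_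
    refine continuous_def.2 fun U hU => ?_
    rw [isOpen_colimitSpaceTopology_iff] at hU
    refine (@isOpen_prod_iff G G (colimitSpaceTopology H _) (colimitSpaceTopology H _) _).2 ?_
    intro f g hfg
    obtain ⟨k₁, hk₁⟩ := hunion f
    obtain ⟨k₂, hk₂⟩ := hunion g
    obtain ⟨A, B, hfA, hgB, hA, hB, hAB⟩ := exists_open_add_subset_of_locallyCompact
      (H := fun n => H (i (k₁ + k₂ + n))) (fun m n hmn => hmono (by lia)) (fun n => hlc _)
      (U := U) (fun n => hU _)
      (hmono (show k₁ ≤ k₁ + k₂ + 0 by lia) hk₁) (hmono (show k₂ ≤ k₁ + k₂ + 0 by lia) hk₂) hfg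
    exact ⟨A, B, isOpen_colimitSpaceTopology_iff.2 (hopen A _ hA),
      isOpen_colimitSpaceTopology_iff.2 (hopen B _ hB), hfA, hgB,
      fun p hp => hAB p.1 hp.1 p.2 hp.2⟩
  · refine @ContinuousNeg.mk G (colimitSpaceTopology H _) _ ?_
    refine continuous_def.2 fun U hU => ?_
    rw [isOpen_colimitSpaceTopology_iff] at hU ⊢
    intro j
    exact (hU j).preimage (continuous_neg (G := H j))

end SequentialColimit

/-! ### The uniform topology -/

section UniformTopology

-- All topological statements about `C_c(X, V)` in this section refer to the uniform topology; the
-- colimit topologies are always named explicitly.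
attribute [local instance] uniformTopology

section Group

variable {X V : Type*} [TopologicalSpace X] [AddCommGroup V] [TopologicalSpace V]
  [IsTopologicalAddGroup V]

theorem hasBasis_nhds_uniformTopology (f : C_c(X, V)) :
    (𝓝 f).HasBasis (fun N : Set V => N ∈ 𝓝 0) (fun N => {g | ∀ x, g x - f x ∈ N}) := by
  let := IsTopologicalAddGroup.rightUniformSpace V
  have : IsUniformAddGroup V := isUniformAddGroup_of_addCommGroup
  rw [nhds_induced]
  exact (UniformFun.hasBasis_nhds_of_basis X V _
    ((basis_sets (𝓝 (0 : V))).uniformity_of_nhds_zero)).comap _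

theorem isTopologicalAddGroup_uniformTopology : IsTopologicalAddGroup C_c(X, V) := by
  let := IsTopologicalAddGroup.rightUniformSpace V
  have : IsUniformAddGroup V := isUniformAddGroup_of_addCommGroup
  let φ : C_c(X, V) →+ UniformFun X V :=
    { toFun := fun f => UniformFun.ofFun (f : X → V)
      map_zero' := rfl
      map_add' := fun _ _ => rfl }
  exact topologicalAddGroup_induced φ

theorem continuous_eval_uniformTopology (x : X) : Continuous fun f : C_c(X, V) => f x := by
  refine continuous_iff_continuousAt.2 fun f => ?_
  have h : Tendsto (fun g : C_c(X, V) => g x - f x) (𝓝 f) (𝓝 0) := by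
    refine (hasBasis_nhds_uniformTopology f).tendsto_left_iff.2 fun N hN =>
      ⟨N, hN, fun g hg => hg x⟩
  simpa [ContinuousAt] using h.add_const (f x)

theorem t2Space_uniformTopology [T2Space V] : T2Space C_c(X, V) :=
  T2Space.of_injective_continuous (f := fun (f : C_c(X, V)) (x : X) => f x)
    DFunLike.coe_injective (continuous_pi continuous_eval_uniformTopology)

theorem apply_eq_zero_of_mem_supportedIn {K : Compacts X} {f : C_c(X, V)}
    (h : f ∈ supportedIn X V K) {x : X} (hx : x ∉ K) : f x = 0 :=
  image_eq_zero_of_notMem_tsupport fun hx' => hx (h hx')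

theorem supportedIn_mono {K L : Compacts X} (h : K ≤ L) :
    supportedIn X V K ≤ supportedIn X V L := fun _ hf => Subset.trans hf h

/-- `SatisfiesACP.exists_add_notMem` for the groups `C_K(X, V)`, in terms of neighbourhoods of `0`
in `V`. -/
theorem SatisfiesACP.exists_add_notMem_supportedIn
    (h : SatisfiesACP (supportedIn X V) (supportedInTopology X V)) {S : Set C_c(X, V)}
    (hS : ∀ K : Compacts X, ∃ C : Set C_c(X, V), IsClosed C ∧
      ∀ f ∈ supportedIn X V K, f ∈ S ↔ f ∈ C)
    (h0 : 0 ∉ S) :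
    ∃ W : Set C_c(X, V), (∀ f ∈ W, ∀ g ∈ W, f + g ∉ S) ∧ ∀ K : Compacts X,
      ∃ N ∈ 𝓝 (0 : V), ∀ f ∈ supportedIn X V K, (∀ x, f x ∈ N) → f ∈ W := by
  obtain ⟨W, h0W, hW, hWS⟩ := h.exists_add_notMem (S := S) (fun K => by
    obtain ⟨C, hC, hCS⟩ := hS K
    have : (Subtype.val : supportedIn X V K → C_c(X, V)) ⁻¹' S = Subtype.val ⁻¹' C := by
      ext f
      exact hCS f f.2
    rw [this]
    exact hC.preimage continuous_subtype_val) h0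
  refine ⟨W, hWS, fun K => ?_⟩
  obtain ⟨O, hO, hOW⟩ := isOpen_induced_iff.1 (hW K)
  have h0O : (0 : C_c(X, V)) ∈ O := by
    have : (0 : supportedIn X V K) ∈ Subtype.val ⁻¹' O := by rw [hOW]; exact h0W
    exact this
  obtain ⟨N, hN, hNO⟩ := (hasBasis_nhds_uniformTopology 0).mem_iff.1 (hO.mem_nhds h0O)
  refine ⟨N, hN, fun f hf hfN => ?_⟩
  have : (⟨f, hf⟩ : supportedIn X V K) ∈ Subtype.val ⁻¹' O := hNO (by simpa using hfN)
  rwa [hOW] at this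

end Group

/-! ### Multiples of a fixed vector by scalar functions -/

theorem IsCompact.eventually_smul_mem {𝕜 V : Type*} [RCLike 𝕜] [AddCommGroup V] [Module 𝕜 V]
    [TopologicalSpace V] [ContinuousSMul 𝕜 V] {B : Set 𝕜} (hB : IsCompact B) {N : Set V}
    (hN : N ∈ 𝓝 0) : ∀ᶠ v in 𝓝 (0 : V), ∀ c ∈ B, c • v ∈ N := by
  refine hB.eventually_forall_of_forall_eventually fun c _ => ?_
  have : Tendsto (fun z : V × 𝕜 => z.2 • z.1) (𝓝 (0, c)) (𝓝 (c • (0 : V))) :=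
    (continuous_snd.smul continuous_fst).tendsto _
  rw [smul_zero] at this
  exact this hN

theorem tendsto_inv_natCast_smul (𝕜 : Type*) [RCLike 𝕜] {V : Type*} [AddCommGroup V] [Module 𝕜 V]
    [TopologicalSpace V] [ContinuousSMul 𝕜 V] (v : V) :
    Tendsto (fun k : ℕ => ((k : 𝕜) + 1)⁻¹ • v) atTop (𝓝 0) := by
  have h : Tendsto (fun k : ℕ => ((k : 𝕜) + 1)⁻¹) atTop (𝓝 0) := by
    simpa using tendsto_one_div_add_atTop_nhds_zero_nat (𝕜 := 𝕜)
  simpa using h.smul_const v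

theorem inv_natCast_smul_ne_zero {𝕜 V : Type*} [RCLike 𝕜] [AddCommGroup V] [Module 𝕜 V]
    {v : V} (hv : v ≠ 0) (k : ℕ) : ((k : 𝕜) + 1)⁻¹ • v ≠ 0 :=
  smul_ne_zero (inv_ne_zero (Nat.cast_add_one_ne_zero k)) hv

section Module

variable {𝕜 : Type*} [RCLike 𝕜] {X V : Type*} [TopologicalSpace X] [AddCommGroup V] [Module 𝕜 V]
  [TopologicalSpace V] [ContinuousSMul 𝕜 V]

/-- The function `x ↦ φ x • v`, for a scalar function `φ` and a vector `v`. -/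
def CompactlySupportedContinuousMap.smulVec (φ : C_c(X, 𝕜)) (v : V) : C_c(X, V) where
  toFun x := φ x • v
  continuous_toFun := (map_continuous φ).smul continuous_const
  hasCompactSupport' := φ.hasCompactSupport.smul_right

@[simp]
theorem CompactlySupportedContinuousMap.smulVec_apply (φ : C_c(X, 𝕜)) (v : V) (x : X) :
    φ.smulVec v x = φ x • v := rfl

theorem tendsto_smulVec [IsTopologicalAddGroup V] (φ : C_c(X, 𝕜)) {ι : Type*} {l : Filter ι}
    {v : ι → V}
    (hv : Tendsto v l (𝓝 0)) : Tendsto (fun k => φ.smulVec (v k)) l (𝓝 0) := by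
  refine (hasBasis_nhds_uniformTopology 0).tendsto_right_iff.2 fun N hN => ?_
  filter_upwards [hv.eventually
    ((φ.hasCompactSupport.isCompact_range (map_continuous φ)).eventually_smul_mem hN)] with k hk x
  simpa using hk _ (mem_range_self x)

end Module

/-- Urysohn's lemma at a point, with scalars in `𝕜`. -/
theorem exists_bump (𝕜 : Type*) [RCLike 𝕜] {X : Type*} [TopologicalSpace X]
    [LocallyCompactSpace X] [T2Space X] {x : X} {U : Set X} (hU : IsOpen U) (hx : x ∈ U) :
    ∃ φ : C_c(X, 𝕜), φ x = 1 ∧ tsupport φ ⊆ U ∧ ∀ y, φ y ∈ Metric.closedBall (0 : 𝕜) 1 := by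
  obtain ⟨f, hf1, hfc, hfU, hf⟩ := exists_continuousMap_one_of_isCompact_subset_isOpen
    (isCompact_singleton (x := x)) hU (singleton_subset_iff.2 hx)
  have hts : tsupport (fun y => (f y : 𝕜)) ⊆ tsupport f :=
    closure_mono fun y hy => by simpa using hy
  refine ⟨⟨⟨fun y => (f y : 𝕜), by fun_prop⟩,
    hfc.of_isClosed_subset (isClosed_tsupport _) hts⟩, ?_, hts.trans hfU, fun y => ?_⟩
  · change (f x : 𝕜) = 1
    simp [hf1 (mem_singleton x)]
  · have := hf y
    change (f y : 𝕜) ∈ Metric.closedBall (0 : 𝕜) 1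
    simp [abs_of_nonneg this.1, this.2]

/-! ### Consequences of ACP -/

theorem isClosed_range_of_forall_not_mapClusterPt {Y : Type*} [TopologicalSpace Y] [T1Space Y]
    {u : ℕ → Y} (h : ∀ y, ¬ MapClusterPt y atTop u) : IsClosed (range u) := by
  rw [← iUnion_singleton_eq_range]
  refine LocallyFinite.isClosed_iUnion (fun y => ?_) fun _ => isClosed_singleton
  have := h y
  simp only [mapClusterPt_iff_frequently, not_forall, not_frequently] at this
  obtain ⟨s, hs, hus⟩ := this
  obtain ⟨n, hn⟩ := eventually_atTop.1 hus
  refine ⟨s, hs, (finite_lt_nat n).subset fun k hk => ?_⟩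
  obtain ⟨z, rfl, hz⟩ := hk
  exact not_le.1 fun hnk => hn k hnk hz

theorem MapClusterPt.of_add_tendsto_zero {G : Type*} [AddGroup G] [TopologicalSpace G]
    [IsTopologicalAddGroup G] {ι : Type*} {l : Filter ι} {a b : ι → G} {x : G}
    (h : MapClusterPt x l (fun k => a k + b k)) (hb : Tendsto b l (𝓝 0)) : MapClusterPt x l a := by
  rw [mapClusterPt_iff_ultrafilter] at h ⊢
  obtain ⟨U, hU, hUx⟩ := h
  refine ⟨U, hU, ?_⟩
  simpa using hUx.sub (hb.mono_left hU)

section LocallyCompact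

variable {X : Type*} [TopologicalSpace X] [LocallyCompactSpace X] [T2Space X]
  {V : Type*} [AddCommGroup V] [TopologicalSpace V] [IsTopologicalAddGroup V]

/-- The key consequence of ACP, for a space `X` with a sequence `y` that leaves every compact set:
each `C_K(X, V)` has a neighbourhood of `0` in which every sequence has a uniform cluster point.
Otherwise there are sequences `a n` without cluster points in smaller and smaller neighbourhoods of
`0`; the functions `a n k + b n k`, where `b n k → 0` as `k → ∞` and `b n k (y n) ≠ 0`, form a
closed set that does not contain `0` but meets `W + W` for every neighbourhood `W` of `0`. -/
theorem SatisfiesACP.exists_nhds_forall_mapClusterPt (𝕜 : Type*) [RCLike 𝕜] [Module 𝕜 V]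
    [ContinuousSMul 𝕜 V] [MetrizableSpace V] [Nontrivial V]
    (h : SatisfiesACP (supportedIn X V) (supportedInTopology X V)) {y : ℕ → X}
    (hy : Tendsto y atTop (cocompact X)) (K : Compacts X) :
    ∃ N ∈ 𝓝 (0 : V), ∀ a : ℕ → C_c(X, V), (∀ k, a k ∈ supportedIn X V K) →
      (∀ k x, a k x ∈ N) → ∃ g, MapClusterPt g atTop a := by
  have := isTopologicalAddGroup_uniformTopology (X := X) (V := V)
  have := t2Space_uniformTopology (X := X) (V := V)
  by_contra! hcon
  obtain ⟨N, hN⟩ := (𝓝 (0 : V)).exists_antitone_basis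
  choose a haK haN ha using fun n => hcon (N n) (hN.1.mem_of_mem trivial)
  obtain ⟨v, hv⟩ := exists_ne (0 : V)
  choose φ hφ _ _ using fun n => exists_bump 𝕜 isOpen_univ (mem_univ (y n))
  let b : ℕ → ℕ → C_c(X, V) := fun n k => (φ n).smulVec (((k : 𝕜) + 1)⁻¹ • v)
  have hb : ∀ n, Tendsto (b n) atTop (𝓝 0) := fun n =>
    tendsto_smulVec (φ n) (tendsto_inv_natCast_smul 𝕜 v)
  have hne : ∀ n k, y n ∉ K → (a n k + b n k) (y n) ≠ 0 := by
    intro n k hn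
    have : a n k (y n) = 0 := apply_eq_zero_of_mem_supportedIn (haK n k) hn
    simpa [b, this, hφ] using inv_natCast_smul_ne_zero (𝕜 := 𝕜) hv k
  have hclosed : ∀ n, IsClosed (range fun k => a n k + b n k) := fun n =>
    isClosed_range_of_forall_not_mapClusterPt fun g hg => ha n g (hg.of_add_tendsto_zero (hb n))
  have hyK : ∀ L : Compacts X, ∀ᶠ n in atTop, y n ∉ L := fun L =>
    hy.eventually L.isCompact.compl_mem_cocompact
  obtain ⟨W, hWS, hW⟩ := h.exists_add_notMem_supportedIn
    (S := {f | ∃ n k, y n ∉ K ∧ a n k + b n k = f})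
    (fun L => by
      obtain ⟨m, hm⟩ := eventually_atTop.1 (hyK L)
      refine ⟨⋃ n ∈ {n | n < m ∧ y n ∉ K}, range fun k => a n k + b n k,
        ((finite_lt_nat m).subset fun n hn => hn.1).isClosed_biUnion fun n _ => hclosed n,
        fun f hf => ?_⟩
      simp only [mem_ofPred_eq, mem_iUnion, mem_range, exists_prop]
      constructor
      · rintro ⟨n, k, hn, rfl⟩
        refine ⟨n, ⟨not_le.1 fun hmn => ?_, hn⟩, k, rfl⟩
        exact hne n k hn (apply_eq_zero_of_mem_supportedIn hf (hm n hmn))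
      · rintro ⟨n, ⟨-, hn⟩, k, rfl⟩
        exact ⟨n, k, hn, rfl⟩)
    (by
      rintro ⟨n, k, hn, h0⟩
      exact hne n k hn (by rw [h0]; rfl))
  obtain ⟨M, hM, hMW⟩ := hW K
  obtain ⟨n, hn, hnM⟩ := ((hyK K).and (hN.eventually_subset hM)).exists
  obtain ⟨M', hM', hMW'⟩ := hW ⟨tsupport (φ n), (φ n).hasCompactSupport⟩
  obtain ⟨k, hk⟩ :=
    ((hb n).eventually ((hasBasis_nhds_uniformTopology 0).mem_of_mem hM')).exists
  refine hWS (a n k) (hMW _ (haK n k) fun x => hnM (haN n k x)) (b n k) (hMW' _ ?_ ?_)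
    ⟨n, k, hn, rfl⟩
  · exact closure_mono fun x hx => left_ne_zero_of_smul hx
  · simpa using hk

/-- A bump function at a point turns a sequence of vectors into a sequence in some `C_K(X, V)`, so
that a neighbourhood of `0` in `V` is totally bounded. -/
theorem SatisfiesACP.finiteDimensional (𝕜 : Type*) [RCLike 𝕜] [Module 𝕜 V]
    [ContinuousSMul 𝕜 V] [MetrizableSpace V] [Nontrivial V]
    (h : SatisfiesACP (supportedIn X V) (supportedInTopology X V)) {y : ℕ → X}
    (hy : Tendsto y atTop (cocompact X)) : FiniteDimensional 𝕜 V := by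
  let := IsTopologicalAddGroup.rightUniformSpace V
  have : IsUniformAddGroup V := isUniformAddGroup_of_addCommGroup
  obtain ⟨φ, hφ, -, hφ1⟩ := exists_bump 𝕜 isOpen_univ (mem_univ (y 0))
  obtain ⟨N, hN, hNa⟩ := h.exists_nhds_forall_mapClusterPt 𝕜 hy
    ⟨tsupport φ, φ.hasCompactSupport⟩
  have hU := (ProperSpace.isCompact_closedBall (0 : 𝕜) 1).eventually_smul_mem hN
  refine FiniteDimensional.of_totallyBounded_nhds_zero 𝕜 hU ?_
  intro D hD
  by_contra! hcon
  obtain ⟨u, huU, hu⟩ : ∃ u : ℕ → V,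
      (∀ n, u n ∈ {v : V | ∀ c ∈ Metric.closedBall (0 : 𝕜) 1, c • v ∈ N}) ∧
      ∀ n m, m < n → (u n, u m) ∉ D := by
    simp only [not_subset, mem_iUnion₂, not_exists, exists_prop] at hcon
    simpa only [forall_and, forall_mem_image, not_and] using! seq_of_forall_finite_exists hcon
  obtain ⟨g, hg⟩ := hNa (fun k => φ.smulVec (u k))
    (fun k => closure_mono fun x hx => left_ne_zero_of_smul hx) (fun k x => huU k _ (hφ1 x))
  have hgu : MapClusterPt (g (y 0)) atTop u := by
    simpa [Function.comp_def, hφ] using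
      hg.continuousAt_comp (continuous_eval_uniformTopology (y 0)).continuousAt
  obtain ⟨E, hE, hEsymm, hED⟩ := comp_symm_mem_uniformity_sets hD
  have hfr := (mapClusterPt_iff_frequently.1 hgu) _ (UniformSpace.ball_mem_nhds _ hE)
  obtain ⟨m, hm⟩ := hfr.exists
  obtain ⟨n, hn, hmn⟩ := (hfr.and_eventually (eventually_gt_atTop m)).exists
  exact hu n m hmn (hED ⟨g (y 0), hEsymm.symm _ _ hn, hm⟩)

/-- Bump functions with disjoint supports inside a compact neighbourhood of a non-isolated point,
multiplied by a fixed small vector, have no uniform cluster point. -/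
theorem SatisfiesACP.discreteTopology (𝕜 : Type*) [RCLike 𝕜] [Module 𝕜 V]
    [ContinuousSMul 𝕜 V] [MetrizableSpace V] [Nontrivial V]
    (h : SatisfiesACP (supportedIn X V) (supportedInTopology X V)) {y : ℕ → X}
    (hy : Tendsto y atTop (cocompact X)) : DiscreteTopology X := by
  refine discreteTopology_iff_isOpen_singleton.2 fun x => ?_
  by_contra hx
  obtain ⟨K, hK, hxK⟩ := exists_compact_mem_nhds x
  have hinf : Infinite (interior K) := by
    by_contra hfin
    rw [not_infinite_iff_finite, Set.finite_coe_iff] at hfin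
    refine hx ?_
    have : ({x} : Set X) = interior K \ (interior K \ {x}) := by
      rw [sdiff_sdiff_right_self]
      refine (inter_eq_right.2 (singleton_subset_iff.2 ?_)).symm
      exact mem_interior_iff_mem_nhds.2 hxK
    rw [this]
    exact isOpen_interior.sdiff hfin.sdiff.isClosed
  obtain ⟨U, hUinf, hUo, hUd⟩ := exists_seq_infinite_isOpen_pairwise_disjoint (interior K)
  choose p hp using fun n => (hUinf n).nonempty
  have hUo' : ∀ n, IsOpen (Subtype.val '' U n : Set X) := fun n =>
    isOpen_interior.isOpenMap_subtype_val _ (hUo n)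
  choose φ hφ hφU hφ1 using fun n => exists_bump 𝕜 (hUo' n) (mem_image_of_mem _ (hp n))
  have hφ0 : ∀ j k, j ≠ k → φ k (p j) = 0 := by
    intro j k hjk
    refine image_eq_zero_of_notMem_tsupport fun hj => ?_
    obtain ⟨z, hz, hzp⟩ := hφU k hj
    rw [Subtype.ext hzp] at hz
    exact disjoint_left.1 (hUd hjk) (hp j) hz
  obtain ⟨N, hN, hNa⟩ := h.exists_nhds_forall_mapClusterPt 𝕜 hy ⟨K, hK⟩
  obtain ⟨v₀, hv₀⟩ := exists_ne (0 : V)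
  obtain ⟨m, hm⟩ := ((tendsto_inv_natCast_smul 𝕜 v₀).eventually
    ((ProperSpace.isCompact_closedBall (0 : 𝕜) 1).eventually_smul_mem hN)).exists
  have hv := inv_natCast_smul_ne_zero (𝕜 := 𝕜) hv₀ m
  set v := ((m : 𝕜) + 1)⁻¹ • v₀
  obtain ⟨g, hg⟩ := hNa (fun k => (φ k).smulVec v)
    (fun k => by
      refine (closure_mono fun x hx => left_ne_zero_of_smul hx).trans ((hφU k).trans ?_)
      rintro _ ⟨z, -, rfl⟩
      exact interior_subset z.2)
    (fun k x => hm _ (hφ1 k x))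
  have hfr : ∀ M ∈ 𝓝 (0 : V), ∃ᶠ k in atTop, ∀ x, φ k x • v - g x ∈ M := fun M hM =>
    (mapClusterPt_iff_frequently.1 hg) _ ((hasBasis_nhds_uniformTopology g).mem_of_mem hM)
  have hg0 : ∀ j, g (p j) = 0 := by
    intro j
    by_contra hj
    obtain ⟨k, hk, hjk⟩ := ((hfr {-g (p j)}ᶜ
      (isOpen_compl_singleton.mem_nhds (by simpa using hj))).and_eventually
      (eventually_gt_atTop j)).exists
    have := hk (p j)
    simp [hφ0 j k hjk.ne] at this
  obtain ⟨k, hk⟩ := (hfr {v}ᶜ (isOpen_compl_singleton.mem_nhds (Ne.symm hv))).exists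
  have := hk (p k)
  simp [hφ, hg0] at this

end LocallyCompact

/-- On an uncountable type there is a function of two variables with values in `ℕ` that no function
of one variable dominates. It comes from `ω₁`, with an injection of each proper initial segment
into `ℕ`. -/
theorem exists_nat_undominated_of_uncountable (X : Type*) [Uncountable X] :
    ∃ c : X → X → ℕ, ∀ β : X → ℕ, ∃ i j, i ≠ j ∧ β i ≤ c i j ∧ β j ≤ c i j := by
  let Y := (Cardinal.aleph 1).ord.ToType
  have hYcard : Cardinal.mk Y = Cardinal.aleph 1 := by simp [Y]
  have hYun : Uncountable Y := by
    rw [← Cardinal.aleph0_lt_mk_iff, hYcard]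
    exact Cardinal.aleph0_lt_aleph_one
  obtain ⟨⟨f, hf⟩⟩ : Nonempty (Y ↪ X) := by
    rw [← Cardinal.le_def, hYcard, Cardinal.aleph_one_le_iff]
    exact Cardinal.aleph0_lt_mk_iff.2 inferInstance
  have hIio : ∀ j : Y, Countable (Iio j) := fun j => by
    rw [← Cardinal.mk_le_aleph0_iff, ← Cardinal.lt_aleph_one_iff]
    exact (Cardinal.mk_Iio_lt j (by simp [Y])).trans_eq hYcard
  choose e he using fun j => (countable_iff_exists_injective (Iio j)).1 (hIio j)
  obtain ⟨g, hg⟩ := hf.hasLeftInverse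
  refine ⟨fun x x' => if h : g x < g x' then e (g x') ⟨g x, h⟩ else 0, fun β => ?_⟩
  -- One value of `β` is taken on an uncountable subset `A` of `ω₁`.
  obtain ⟨n, hA⟩ : ∃ n, ¬ {i : Y | β (f i) = n}.Countable := by
    by_contra! hcon
    refine not_countable_univ (α := Y) ((countable_iUnion hcon).mono fun i _ => ?_)
    exact mem_iUnion.2 ⟨β (f i), rfl⟩
  set A := {i : Y | β (f i) = n}
  have hAinf : A.Infinite := fun hfin => hA hfin.countable
  obtain ⟨B, hBA, hBinf, hBc⟩ : ∃ B ⊆ A, B.Infinite ∧ B.Countable := by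
    have := hAinf.to_subtype
    let r := Infinite.natEmbedding A
    exact ⟨range fun k => (r k : Y), by rintro _ ⟨k, rfl⟩; exact (r k).2,
      infinite_range_of_injective (Subtype.val_injective.comp r.injective), countable_range _⟩
  -- Some `j ∈ A` lies above the countable infinite subset `B` of `A`.
  obtain ⟨j, hjA, hj⟩ : ∃ j ∈ A, ∀ b ∈ B, b < j := by
    by_contra! hcon
    refine hA ((hBc.biUnion (t := fun b _ => Iic b) fun b _ => ?_).mono fun j hj => ?_)
    · rw [← Iio_insert]
      exact (Set.countable_coe_iff.1 (hIio b)).insert b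
    · obtain ⟨b, hb, hjb⟩ := hcon j hj
      exact mem_biUnion hb hjb
  obtain ⟨i, hi, hin⟩ : ∃ i, ∃ h : i ∈ B, n ≤ e j ⟨i, hj i h⟩ := by
    by_contra! hcon
    have := hBinf.to_subtype
    refine not_injective_infinite_finite
      (fun b : B => (⟨e j ⟨b, hj b b.2⟩, hcon b b.2⟩ : Fin n)) fun b b' hbb' => ?_
    exact Subtype.ext (Subtype.mk.inj (he j (Fin.mk.inj hbb')))
  have hc : n ≤ if h : g (f i) < g (f j) then e (g (f j)) ⟨g (f i), h⟩ else 0 := by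
    have key : ∀ i' j', i' = i → j' = j → n ≤ if h : i' < j' then e j' ⟨i', h⟩ else 0 := by
      rintro _ _ rfl rfl
      rwa [dif_pos (hj _ hi)]
    exact key _ _ (hg i) (hg j)
  exact ⟨f i, f j, fun hij => (hj i hi).ne (hf hij), (hBA hi).le.trans hc, hjA.le.trans hc⟩

/-- If `X` is discrete and uncountable and `c` is as in `exists_nat_undominated_of_uncountable`,
then the functions with value `v / (c i j + 1)` at `i` and at `j`, and zero elsewhere, form a closed
set that does not contain `0` but meets `W + W` for every neighbourhood `W` of `0`. -/
theorem SatisfiesACP.countable (𝕜 : Type*) [RCLike 𝕜] {X : Type*} [TopologicalSpace X]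
    [DiscreteTopology X] {V : Type*} [AddCommGroup V] [Module 𝕜 V] [TopologicalSpace V]
    [IsTopologicalAddGroup V] [ContinuousSMul 𝕜 V] [T2Space V] [Nontrivial V]
    (h : SatisfiesACP (supportedIn X V) (supportedInTopology X V)) : Countable X := by
  have := t2Space_uniformTopology (X := X) (V := V)
  by_contra hX
  rw [not_countable_iff] at hX
  obtain ⟨c, hc⟩ := exists_nat_undominated_of_uncountable X
  obtain ⟨v, hv⟩ := exists_ne (0 : V)
  choose δ hδ hδi _ using fun i : X => exists_bump 𝕜 (isOpen_discrete {i}) (mem_singleton i)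
  have hδ0 : ∀ i j, i ≠ j → δ i j = 0 := fun i j hij =>
    image_eq_zero_of_notMem_tsupport fun hj => hij (hδi i hj).symm
  let e : X → ℕ → C_c(X, V) := fun i m => (δ i).smulVec (((m : 𝕜) + 1)⁻¹ • v)
  have hne : ∀ i j m, i ≠ j → (e i m + e j m) i ≠ 0 ∧ (e i m + e j m) j ≠ 0 := by
    intro i j m hij
    have := inv_natCast_smul_ne_zero (𝕜 := 𝕜) hv m
    simpa [e, hδ, hδ0 i j hij, hδ0 j i hij.symm] using this
  obtain ⟨W, hWS, hW⟩ := h.exists_add_notMem_supportedIn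
    (S := {f | ∃ i j, i ≠ j ∧ e i (c i j) + e j (c i j) = f})
    (fun K => by
      have hK : (K : Set X).Finite := K.isCompact.finite_of_discrete
      refine ⟨(fun p : X × X => e p.1 (c p.1 p.2) + e p.2 (c p.1 p.2)) ''
          {p ∈ (K : Set X) ×ˢ (K : Set X) | p.1 ≠ p.2},
        (((hK.prod hK).subset fun p hp => hp.1).image _).isClosed, fun f hf => ?_⟩
      constructor
      · rintro ⟨i, j, hij, rfl⟩
        have hij' := hne i j (c i j) hij
        exact ⟨(i, j), ⟨⟨not_imp_comm.1 (apply_eq_zero_of_mem_supportedIn hf) hij'.1,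
          not_imp_comm.1 (apply_eq_zero_of_mem_supportedIn hf) hij'.2⟩, hij⟩, rfl⟩
      · rintro ⟨p, hp, rfl⟩
        exact ⟨p.1, p.2, hp.2, rfl⟩)
    (by
      rintro ⟨i, j, hij, h0⟩
      exact (hne i j _ hij).1 (by rw [h0]; rfl))
  have hβ : ∀ i, ∃ n, ∀ m ≥ n, e i m ∈ W := by
    intro i
    obtain ⟨M, hM, hMW⟩ := hW ⟨tsupport (δ i), (δ i).hasCompactSupport⟩
    obtain ⟨n, hn⟩ := eventually_atTop.1
      ((tendsto_smulVec (δ i) (tendsto_inv_natCast_smul 𝕜 v)).eventually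
        ((hasBasis_nhds_uniformTopology 0).mem_of_mem hM))
    refine ⟨n, fun m hm => hMW _ (closure_mono fun x hx => left_ne_zero_of_smul hx) ?_⟩
    simpa [e] using hn m hm
  choose β hβ using hβ
  obtain ⟨i, j, hij, hi, hj⟩ := hc β
  exact hWS _ (hβ i _ hi) _ (hβ j _ hj) ⟨i, j, hij, rfl⟩

/-! ### Finite-dimensional values on a countable discrete space -/

section Discrete

variable {X V : Type*} [TopologicalSpace X] [DiscreteTopology X] [AddCommGroup V]
  [TopologicalSpace V] [IsTopologicalAddGroup V]

/-- On a discrete space, the extension by zero of a function on a compact set. -/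
noncomputable def extendByZero (K : Compacts X) (p : K → V) : supportedIn X V K :=
  have hsupp : tsupport (Function.extend Subtype.val p 0) ⊆ (K : Set X) :=
    closure_minimal (fun _ hx => by_contra fun hxK => hx
      (Function.extend_apply' _ _ _ fun ⟨a, ha⟩ => hxK (ha ▸ a.2))) (isClosed_discrete _)
  ⟨⟨⟨Function.extend Subtype.val p 0, continuous_of_discreteTopology⟩,
    K.isCompact.of_isClosed_subset (isClosed_tsupport _) hsupp⟩, hsupp⟩

theorem extendByZero_apply_of_mem {K : Compacts X} (p : K → V) (x : K) :
    (extendByZero K p : C_c(X, V)) x = p x :=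
  Subtype.val_injective.extend_apply _ _ x

theorem extendByZero_apply_of_notMem {K : Compacts X} (p : K → V) {x : X} (hx : x ∉ K) :
    (extendByZero K p : C_c(X, V)) x = 0 :=
  Function.extend_apply' _ _ _ fun ⟨a, ha⟩ => hx (ha ▸ a.2)

/-- On a discrete space, `C_K(X, V)` is a finite power of `V`. -/
noncomputable def supportedInHomeomorph (K : Compacts X) : supportedIn X V K ≃ₜ (K → V) where
  toFun f x := (f : C_c(X, V)) x
  invFun := extendByZero K
  left_inv f := by
    refine Subtype.ext (CompactlySupportedContinuousMap.ext fun x => ?_)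
    by_cases hx : x ∈ K
    · exact extendByZero_apply_of_mem _ ⟨x, hx⟩
    · rw [extendByZero_apply_of_notMem _ hx, apply_eq_zero_of_mem_supportedIn f.2 hx]
  right_inv p := funext fun x => extendByZero_apply_of_mem p x
  continuous_toFun := continuous_pi fun x =>
    (continuous_eval_uniformTopology (x : X)).comp continuous_subtype_val
  continuous_invFun := by
    have hK : Finite K := K.isCompact.finite_of_discrete
    refine continuous_induced_rng.2 (continuous_iff_continuousAt.2 fun p => ?_)
    refine (hasBasis_nhds_uniformTopology _).tendsto_right_iff.2 fun N hN => ?_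
    have : ∀ x : K, ∀ᶠ q in 𝓝 p, q x - p x ∈ N := fun x => by
      have hc : Tendsto (fun q : K → V => q x - p x) (𝓝 p) (𝓝 (p x - p x)) :=
        ((continuous_apply x).sub continuous_const).tendsto p
      rw [sub_self] at hc
      exact hc hN
    filter_upwards [eventually_all.2 this] with q hq x
    by_cases hx : x ∈ K
    · simpa [extendByZero_apply_of_mem _ (⟨x, hx⟩ : K)] using hq ⟨x, hx⟩
    · simpa [extendByZero_apply_of_notMem _ hx] using mem_of_mem_nhds hN

theorem locallyCompactSpace_supportedIn [LocallyCompactSpace V] (K : Compacts X) :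
    LocallyCompactSpace (supportedIn X V K) := by
  have hK : Finite K := K.isCompact.finite_of_discrete
  exact (supportedInHomeomorph K).isClosedEmbedding.locallyCompactSpace

theorem satisfiesACP_of_homeomorph_nat [LocallyCompactSpace V] (e : X ≃ₜ ℕ) :
    SatisfiesACP (supportedIn X V) (supportedInTopology X V) := by
  have := isTopologicalAddGroup_uniformTopology (X := X) (V := V)
  have hfin : ∀ n, (e ⁻¹' Iic n).Finite := fun n => (finite_Iic n).preimage e.injective.injOn
  let K : ℕ → Compacts X := fun n => ⟨e ⁻¹' Iic n, (hfin n).isCompact⟩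
  have hcof : ∀ L : Compacts X, ∃ n, L ≤ K n := fun L => by
    obtain ⟨n, hn⟩ := (L.isCompact.image e.continuous).bddAbove
    exact ⟨n, fun x hx => hn (mem_image_of_mem _ hx)⟩
  refine satisfiesACP_of_locallyCompact (supportedIn X V) K
    (fun m n hmn => supportedIn_mono (show e ⁻¹' Iic m ⊆ e ⁻¹' Iic n from
      preimage_mono (Iic_subset_Iic.2 hmn)))
    (fun L => (hcof L).imp fun n hn => supportedIn_mono hn) (fun f => ?_)
    fun n => locallyCompactSpace_supportedIn (K n)
  exact (hcof ⟨tsupport f, f.hasCompactSupport⟩).imp fun n hn => hn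

end Discrete

/-! ### Sequences that leave every compact set -/

theorem exists_tendsto_cocompact_of_not_isPseudocompact {X : Type*} [TopologicalSpace X]
    (h : ¬ IsPseudocompact X) : ∃ y : ℕ → X, Tendsto y atTop (cocompact X) := by
  simp only [IsPseudocompact, not_forall, not_exists, not_le] at h
  obtain ⟨f, hf, hub⟩ := h
  choose y hy using fun n : ℕ => hub n
  refine ⟨y, (hasBasis_cocompact.tendsto_right_iff).2 fun K hK => ?_⟩
  obtain ⟨M, hM⟩ := hK.exists_bound_of_continuousOn hf.continuousOn
  filter_upwards [tendsto_natCast_atTop_atTop.eventually (eventually_ge_atTop M)] with n hn hnK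
  exact ((hM _ hnK).trans hn).not_gt (hy n)

theorem exists_tendsto_cocompact_of_isSigmaCompact {X : Type*} [TopologicalSpace X]
    [LocallyCompactSpace X] {A : Set X} (hA : IsClosed A) (hσ : IsSigmaCompact A)
    (hc : ¬ IsCompact A) : ∃ y : ℕ → X, Tendsto y atTop (cocompact X) := by
  have := isSigmaCompact_iff_sigmaCompactSpace.1 hσ
  have := hA.isClosedEmbedding_subtypeVal.locallyCompactSpace
  let C := CompactExhaustion.choice A
  have hex : ∀ n, ∃ y : A, y ∉ C n := by
    intro n
    by_contra! hcon
    refine hc (isCompact_iff_isCompact_univ.2 ?_)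
    rw [← eq_univ_of_forall hcon]
    exact C.isCompact n
  choose y hy using hex
  refine ⟨fun n => y n, hA.isClosedEmbedding_subtypeVal.tendsto_cocompact.comp
    ((hasBasis_cocompact.tendsto_right_iff).2 fun K hK => ?_)⟩
  obtain ⟨m, hm⟩ := C.exists_superset_of_isCompact hK
  filter_upwards [eventually_ge_atTop m] with n hn hnK
  exact hy n (C.subset hn (hm hnK))

/-! ### The characterization of ACP -/

theorem satisfiesACP_iff_of_tendsto_cocompact {𝕜 : Type*} [RCLike 𝕜] {X : Type*}
    [TopologicalSpace X] [LocallyCompactSpace X] [T2Space X] {V : Type*} [AddCommGroup V]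
    [Module 𝕜 V] [TopologicalSpace V] [IsTopologicalAddGroup V] [ContinuousSMul 𝕜 V]
    [MetrizableSpace V] [Nontrivial V] {y : ℕ → X} (hy : Tendsto y atTop (cocompact X)) :
    SatisfiesACP (supportedIn X V) (supportedInTopology X V) ↔
      Nonempty (X ≃ₜ ℕ) ∧ FiniteDimensional 𝕜 V := by
  constructor
  · intro h
    have := h.discreteTopology 𝕜 hy
    have := h.countable 𝕜
    have hX : Infinite X := by
      by_contra hfin
      rw [not_infinite_iff_finite] at hfin
      have hbot := hy.neBot
      rw [cocompact_eq_bot] at hbot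
      exact hbot.ne rfl
    obtain ⟨_⟩ := nonempty_denumerable X
    exact ⟨⟨(Denumerable.eqv X).toHomeomorphOfDiscrete⟩, h.finiteDimensional 𝕜 hy⟩
  · rintro ⟨⟨e⟩, _⟩
    have := e.symm.discreteTopology
    have := LocallyCompactSpace.of_finiteDimensional_of_complete 𝕜 V
    exact satisfiesACP_of_homeomorph_nat e

end UniformTopology

theorem theoremB {𝕜 : Type*} [RCLike 𝕜]
    {X : Type*} [TopologicalSpace X] [LocallyCompactSpace X] [T2Space X]
    {V : Type*} [AddCommGroup V] [Module 𝕜 V] [TopologicalSpace V] [IsTopologicalAddGroup V]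
    [ContinuousSMul 𝕜 V] [TopologicalSpace.MetrizableSpace V] [Nontrivial V] :
    (¬ IsPseudocompact X →
      (SatisfiesACP (supportedIn X V) (supportedInTopology X V) ↔
        Nonempty (X ≃ₜ ℕ) ∧ FiniteDimensional 𝕜 V)) ∧
    ((∃ A : Set X, IsRegularClosed A ∧ IsSigmaCompact A ∧ ¬ IsCompact A) →
      (SatisfiesACP (supportedIn X V) (supportedInTopology X V) ↔
        Nonempty (X ≃ₜ ℕ) ∧ FiniteDimensional 𝕜 V)) := by
  refine ⟨fun h => ?_, fun ⟨A, hA, hσ, hc⟩ => ?_⟩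
  · obtain ⟨y, hy⟩ := exists_tendsto_cocompact_of_not_isPseudocompact h
    exact satisfiesACP_iff_of_tendsto_cocompact hy
  · have hA' : IsClosed A := by
      rw [← hA]
      exact isClosed_closure
    obtain ⟨y, hy⟩ := exists_tendsto_cocompact_of_isSigmaCompact hA' hσ hc
    exact satisfiesACP_iff_of_tendsto_cocompact hy
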